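/- In Online Sum-Radii Clustering, an opening cost $f>0$ and a metric space $(M,d)$ are given, and demand points $u_1,\dots,u_n\in M$ (not necessarily distinct) arrive one by one. A cluster $C(p,r)=\{v : d(p,v)\le r\}$, with $p \in M$ and $r\ge 0$, costs $f+r$. Upon the arrival of each demand, an online algorithm, which knows only the demands revealed so far, may irrevocably open new clusters with fixed center and radius, so that the new demand is covered by some open cluster; a randomized algorithm is a random choice of such an algorithm. In a tree metric, $M$ is the node set of a tree with positive integer edge lengths and $d$ is its shortest path metric. The competitive ratio on sequences of $n$ demands is the least $\rho \in [0,\infty]$ such that, for every fixed sequence of $n$ demands, the expected cost of the algorithm is at most $\rho$ times the minimum total cost of a collection of clusters covering all the demands. The competitive ratio of every randomized online algorithm for Online Sum-Radii Clustering in tree metrics is $\Omega(\log\log n)$, where $n$ is the number of demands. That is, there are absolute constants $c>0$ and $N$ such that for every $n\ge N$ there are a finite tree with positive integer edge lengths and an opening cost $f>0$ for which every randomized online algorithm (even one that is designed for this tree, $f$ and $n$) has competitive ratio at least $c\log\log n$ on sequences of $n$ demands. -/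

import Mathlib

open scoped NNReal ENNReal

/-- A tree on the node set `V` whose edges have positive integer lengths. -/
structure WeightedTree (V : Type*) where
  graph : SimpleGraph V
  isTree : graph.IsTree
  length : Sym2 V → ℕ
  length_pos : ∀ e ∈ graph.edgeSet, 0 < length e

/-- The shortest path metric of a weighted tree: the least total edge length of a walk
from `u` to `v`. -/
noncomputable def WeightedTree.dist {V : Type*} (T : WeightedTree V) (u v : V) : ℕ :=
  sInf (Set.range fun p : T.graph.Walk u v => (p.edges.map T.length).sum)

namespace SumRadii

/-- A cluster `C(p, r)`, given by its center `p` and its radius `r ≥ 0`. -/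
structure Cluster (M : Type*) where
  center : M
  radius : ℝ≥0

variable {M : Type*}

/-- The point `v` lies in the cluster `C(p, r)`, that is, `d(p, v) ≤ r`. -/
def Cluster.Covers (d : M → M → ℕ) (C : Cluster M) (v : M) : Prop :=
  (d C.center v : ℝ≥0) ≤ C.radius

/-- Total cost of a finite collection of clusters: each costs the opening cost `f` plus
its radius. -/
noncomputable def totalCost (f : ℝ≥0) (S : List (Cluster M)) : ℝ≥0 :=
  (S.map fun C => f + C.radius).sum

/-- The cost of an optimal offline solution for the demand sequence `σ`. -/
noncomputable def opt (d : M → M → ℕ) (f : ℝ≥0) (σ : List M) : ℝ≥0 :=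
  sInf {x | ∃ S : List (Cluster M), (∀ u ∈ σ, ∃ C ∈ S, C.Covers d u) ∧ totalCost f S = x}

/-- All clusters opened on the demand sequence `σ` by the rule `respond`, which is told the
demands revealed so far (in order of arrival, the newest one last) and returns the
clusters that it opens in response to the newest one. -/
def clustersOf (respond : List M → List (Cluster M)) (σ : List M) : List (Cluster M) :=
  (List.range σ.length).flatMap fun i => respond (σ.take (i + 1))

/-- A deterministic online algorithm in the metric space `(M, d)`. On each arrival it
irrevocably opens finitely many (possibly no) new clusters with fixed centers and radii, so
that the new demand is covered by some cluster opened so far. -/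
structure OnlineAlgorithm (d : M → M → ℕ) where
  respond : List M → List (Cluster M)
  covers : ∀ (past : List M) (u : M), ∃ C ∈ clustersOf respond (past ++ [u]), C.Covers d u

/-- The cost incurred by a deterministic online algorithm on the demand sequence `σ`. -/
noncomputable def OnlineAlgorithm.cost {d : M → M → ℕ} (A : OnlineAlgorithm d)
    (f : ℝ≥0) (σ : List M) : ℝ≥0 :=
  totalCost f (clustersOf A.respond σ)

/-- A randomized online algorithm with random seed in `Ω`: a family of deterministic online
algorithms such that the cost on each demand sequence is a random variable. -/
structure RandomizedAlgorithm (d : M → M → ℕ) (f : ℝ≥0) (Ω : Type*) [MeasurableSpace Ω] where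
  alg : Ω → OnlineAlgorithm d
  measurable_cost : ∀ σ : List M, Measurable fun ω => (alg ω).cost f σ

/-- The expected cost of a randomized algorithm on the (fixed in advance) demand
sequence `σ`, when its seed is distributed according to `P`. -/
noncomputable def RandomizedAlgorithm.expectedCost {d : M → M → ℕ} {f : ℝ≥0} {Ω : Type*}
    [MeasurableSpace Ω] (A : RandomizedAlgorithm d f Ω) (P : MeasureTheory.Measure Ω)
    (σ : List M) : ℝ≥0∞ :=
  ∫⁻ ω, ((A.alg ω).cost f σ : ℝ≥0∞) ∂P

/-- The algorithm is `ρ`-competitive on demand sequences with `n` demands: its expected cost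
is at most `ρ` times the optimal cost. -/
def RandomizedAlgorithm.IsCompetitive {d : M → M → ℕ} {f : ℝ≥0} {Ω : Type*}
    [MeasurableSpace Ω] (A : RandomizedAlgorithm d f Ω) (P : MeasureTheory.Measure Ω)
    (n : ℕ) (ρ : ℝ≥0∞) : Prop :=
  ∀ σ : List M, σ.length = n → A.expectedCost P σ ≤ ρ * (opt d f σ : ℝ≥0∞)

/-- The competitive ratio on demand sequences with `n` demands. -/
noncomputable def RandomizedAlgorithm.competitiveRatio {d : M → M → ℕ} {f : ℝ≥0} {Ω : Type*}
    [MeasurableSpace Ω] (A : RandomizedAlgorithm d f Ω) (P : MeasureTheory.Measure Ω)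
    (n : ℕ) : ℝ≥0∞ :=
  sInf {ρ | A.IsCompetitive P n ρ}

end SumRadii

/-!
The hard instance is the complete `B`-ary tree of depth `K = 2 ^ B` with opening cost `1` and edge
lengths doubling from one level to the next, such that a ball around a node of height `j` that
covers the subtree of this node costs `2 ^ j`. A ball that covers a leaf without being centered in
the subtree of its ancestor of height `j` costs at least `2 ^ (j + 1)`, so in effect clusters are
subtrees.

By Yao's principle it suffices to find a random sequence of leaves that is expensive for every
deterministic online algorithm but cheap offline. In the subtree of a node of height `j + 1`, the
children are visited in turn, each visit being a recursive sample at height `j`, and after each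
visit the process stops with probability `1 / 2`. The mean number of visits is `2 - 2 / 2 ^ B`.

* Online (`le_expect_visit`, `le_expect_spent`): the stopping rule is memoryless, so at no time is
  the expected number of future visits more than at the outset. Buying the entire subtree for
  `2 ^ (j + 1)` therefore never pays off against serving the children separately, and the expected
  cost at height `j` is at least `(2 - 2 / 2 ^ B) ^ j`, which for `j = K` is at least `2 ^ K / 4`.
* Offline (`expect_visit_le`, `expect_opt_le`): buy the subtree if the process survives all `B`
  visits, which has probability `2⁻ᴮ`, and serve the visited children recursively otherwise. The
  subtrees bought save about `B` visits each, so the cost relative to `2 ^ j` decreases with the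
  height to the fixed point `2 / (B + 2)` of an affine recursion, and `2 ^ B` levels suffice to come
  within a constant factor of it (`optRatio_le`).

So the ratio is at least `(B + 2) / 16`. The sequences have at most `B ^ 2 ^ B ≤ 2 ^ 4 ^ B` demands
and are filled up to `n` by repeating a demand, which leaves `B` of order `log (log n)`.
-/

/-! ### The complete `B`-ary tree of depth `K` -/

/-- The nodes of the complete `B`-ary tree of depth `K`: the sequences of at most `K` branching
choices, the most recent choice at the head. The root is `[]`, the children of `v` are the lists
`c :: v`, and `w` is an ancestor of `v` (or `v` itself) if `w <:+ v`. -/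
abbrev TreeNode (B K : ℕ) : Type := {l : List (Fin B) // l.length ≤ K}

namespace TreeNode

variable {B K : ℕ}

noncomputable instance : Fintype (TreeNode B K) :=
  (List.finite_length_le (Fin B) K).fintype

/-- The root of the tree. -/
def root : TreeNode B K := ⟨[], Nat.zero_le _⟩

/-- The child of `v` in direction `c`; the junk value `v` if `v` is a leaf. -/
def child (v : TreeNode B K) (c : Fin B) : TreeNode B K :=
  if h : v.1.length < K then ⟨c :: v.1, h⟩ else v

lemma child_val {v : TreeNode B K} (h : v.1.length < K) (c : Fin B) :
    (v.child c).1 = c :: v.1 := by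
  simp [child, h]

/-- The leaf `u` lies in the subtree of `v`. -/
def IsLeafBelow (v u : TreeNode B K) : Prop := u.1.length = K ∧ v.1 <:+ u.1

lemma IsLeafBelow.of_child {v u : TreeNode B K} (h : v.1.length < K) {c : Fin B}
    (hu : IsLeafBelow (v.child c) u) : IsLeafBelow v u := by
  refine ⟨hu.1, List.IsSuffix.trans ?_ hu.2⟩
  rw [child_val h]
  exact List.suffix_cons _ _

/-- The graph that joins each node to its children. -/
def graph (B K : ℕ) : SimpleGraph (TreeNode B K) where
  Adj u v := (∃ c, v.1 = c :: u.1) ∨ ∃ c, u.1 = c :: v.1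
  symm := ⟨fun _ _ h => h.symm⟩
  loopless := ⟨fun u h => by rcases h with ⟨c, h⟩ | ⟨c, h⟩ <;> simpa using congrArg List.length h⟩

lemma graph_connected : (graph B K).Connected := by
  have key : ∀ (l : List (Fin B)) (h : l.length ≤ K), (graph B K).Reachable root ⟨l, h⟩ := by
    intro l
    induction l with
    | nil => intro h; exact SimpleGraph.Reachable.refl _
    | cons c l ih =>
      intro h
      have h' : l.length ≤ K := (Nat.le_succ _).trans h
      exact (ih h').trans (SimpleGraph.Adj.reachable (Or.inl ⟨c, rfl⟩))
  have : Nonempty (TreeNode B K) := ⟨root⟩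
  exact ⟨fun u v => (key u.1 u.2).symm.trans (key v.1 v.2)⟩

lemma graph_isTree : (graph B K).IsTree := by
  rw [SimpleGraph.isTree_iff_connected_and_card]
  refine ⟨graph_connected, le_antisymm ?_ graph_connected.card_vert_le_card_edgeSet_add_one⟩
  -- every edge joins some node other than the root to its parent
  let parent : TreeNode B K → TreeNode B K := fun v =>
    ⟨v.1.tail, by have := v.2; rw [List.length_tail]; omega⟩
  have hsub : (graph B K).edgeSet ⊆ (fun v => s(v, parent v)) '' {root}ᶜ := by
    have key : ∀ u v : TreeNode B K, (∃ c, v.1 = c :: u.1) →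
        s(v, u) ∈ (fun v => s(v, parent v)) '' ({root}ᶜ : Set (TreeNode B K)) := by
      rintro u v ⟨c, hc⟩
      have hu : parent v = u := Subtype.ext (by simp [parent, hc])
      refine ⟨v, ?_, by simp only [hu]⟩
      rintro rfl
      simp [root] at hc
    intro e
    induction e using Sym2.ind with
    | _ u v =>
      rintro (h | h)
      · rw [Sym2.eq_swap]; exact key _ _ h
      · exact key _ _ h
  have h1 := (Set.ncard_le_ncard hsub (Set.toFinite _)).trans (Set.ncard_image_le (Set.toFinite _))
  have h2 := Set.ncard_compl ({root} : Set (TreeNode B K))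
  have h3 : 0 < Nat.card (TreeNode B K) := by
    have : Nonempty (TreeNode B K) := ⟨root⟩
    exact Nat.card_pos
  rw [Set.ncard_singleton] at h2
  rw [Nat.card_coe_set_eq]
  omega

/-- The `B`-ary tree of depth `K` in which an edge whose lower endpoint has height `j` has length
`2 ^ j`, so that the leaves are at distance `2 ^ j - 1` from each ancestor of height `j`. -/
def tree (B K : ℕ) : WeightedTree (TreeNode B K) where
  graph := graph B K
  isTree := graph_isTree
  length := Sym2.lift ⟨fun u v => 2 ^ (K - max u.1.length v.1.length), fun u v => by
    simp only [max_comm]⟩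
  length_pos e _ := by
    induction e using Sym2.ind with
    | _ u v => simp

lemma length_mk (u v : TreeNode B K) :
    (tree B K).length s(u, v) = 2 ^ (K - max u.1.length v.1.length) := rfl

lemma exists_walk_of_suffix (v : TreeNode B K) : ∀ (l : List (Fin B)) (h : (l ++ v.1).length ≤ K),
    ∃ p : (graph B K).Walk ⟨l ++ v.1, h⟩ v,
      (p.edges.map (tree B K).length).sum + 2 ^ (K - (l ++ v.1).length) = 2 ^ (K - v.1.length) := by
  intro l
  induction l with
  | nil => intro h; exact ⟨SimpleGraph.Walk.nil, by simp⟩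
  | cons c l ih =>
    intro h
    have h' : (l ++ v.1).length ≤ K := (Nat.le_succ _).trans h
    obtain ⟨p, hp⟩ := ih h'
    have hadj : (graph B K).Adj ⟨c :: l ++ v.1, h⟩ ⟨l ++ v.1, h'⟩ := Or.inr ⟨c, rfl⟩
    refine ⟨SimpleGraph.Walk.cons hadj p, ?_⟩
    rw [SimpleGraph.Walk.edges_cons, List.map_cons, List.sum_cons, length_mk, ← hp]
    have e1 : max (c :: l ++ v.1).length (l ++ v.1).length = (l ++ v.1).length + 1 := by
      simp [add_assoc]
    have e2 : (c :: l ++ v.1).length = (l ++ v.1).length + 1 := by simp [add_assoc]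
    have e3 : K - (l ++ v.1).length = K - ((l ++ v.1).length + 1) + 1 := by
      rw [e2] at h; omega
    rw [e1, e2, e3, pow_succ]
    ring

lemma dist_add_one_le_of_isLeafBelow {v u : TreeNode B K} (h : IsLeafBelow v u) :
    (tree B K).dist v u + 1 ≤ 2 ^ (K - v.1.length) := by
  obtain ⟨u, hK⟩ := u
  obtain ⟨hu, l, rfl⟩ := h
  obtain ⟨p, hp⟩ := exists_walk_of_suffix v l hK
  simp only at hu
  rw [hu, Nat.sub_self, pow_zero] at hp
  rw [← hp, Nat.add_le_add_iff_right, ← List.sum_reverse, ← List.map_reverse,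
    ← SimpleGraph.Walk.edges_reverse]
  exact Nat.sInf_le (Set.mem_range_self (f := fun q : (tree B K).graph.Walk v _ =>
    (q.edges.map (tree B K).length).sum) p.reverse)

open Classical in
/-- A potential that changes by at most the length of an edge along the edge: it vanishes outside
the subtree of `w`, and at a node of height `i` in this subtree it is `2 ^ (j + 1) - 2 ^ i`, where
`j` is the height of `w`. -/
noncomputable def potential (w v : TreeNode B K) : ℤ :=
  if w.1 <:+ v.1 then 2 * 2 ^ (K - w.1.length) - 2 ^ (K - v.1.length) else 0

lemma abs_potential_sub_le {w u v : TreeNode B K} (h : (graph B K).Adj u v) :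
    |potential w v - potential w u| ≤ (tree B K).length s(u, v) := by
  have key : ∀ u v : TreeNode B K, (∃ c, v.1 = c :: u.1) →
      |potential w v - potential w u| ≤ (tree B K).length s(u, v) := by
    rintro u v ⟨c, hc⟩
    have hv := v.2
    have e1 : v.1.length = u.1.length + 1 := by rw [hc, List.length_cons]
    have e2 : K - u.1.length = (K - v.1.length) + 1 := by omega
    have e3 : max u.1.length v.1.length = v.1.length := by omega
    rw [length_mk, e3]
    push_cast
    have hpos : (0 : ℤ) < 2 ^ (K - v.1.length) := by positivity
    by_cases h1 : w.1 <:+ u.1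
    · have h2 : w.1 <:+ v.1 := by rw [hc]; exact h1.trans (List.suffix_cons _ _)
      rw [potential, potential, if_pos h1, if_pos h2, e2, abs_le, pow_succ]
      constructor <;> linarith
    · by_cases h2 : w.1 <:+ v.1
      · have h3 : w.1 = v.1 := by
          rw [hc, List.suffix_cons_iff] at h2
          rw [hc]
          exact h2.resolve_right h1
        rw [potential, potential, if_neg h1, if_pos h2, h3, abs_le]
        constructor <;> linarith
      · rw [potential, potential, if_neg h1, if_neg h2]
        simp
  rcases h with h | h
  · exact key u v h
  · rw [abs_sub_comm, Sym2.eq_swap]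
    exact key v u h

lemma potential_sub_le_walk {w u v : TreeNode B K} (p : (graph B K).Walk u v) :
    potential w v - potential w u ≤ ((p.edges.map (tree B K).length).sum : ℕ) := by
  induction p with
  | nil => simp
  | cons h p ih =>
    have := (abs_le.1 (abs_potential_sub_le (w := w) h)).2
    rw [SimpleGraph.Walk.edges_cons, List.map_cons, List.sum_cons]
    push_cast at ih ⊢
    linarith

/-- Outside the subtree of a node of height `j`, every node is at distance at least
`2 ^ (j + 1) - 1` from each leaf of this subtree. -/
lemma le_dist_add_one {w p u : TreeNode B K} (hu : IsLeafBelow w u) (hp : ¬ w.1 <:+ p.1) :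
    2 ^ (K - w.1.length + 1) ≤ (tree B K).dist p u + 1 := by
  have hne : (Set.range fun q : (tree B K).graph.Walk p u =>
      (q.edges.map (tree B K).length).sum).Nonempty := by
    obtain ⟨q⟩ := (graph_connected (B := B) (K := K)).preconnected p u
    exact ⟨_, q, rfl⟩
  obtain ⟨q, hq⟩ := Nat.sInf_mem hne
  have : potential w u - potential w p ≤ ((q.edges.map (tree B K).length).sum : ℕ) :=
    potential_sub_le_walk q
  rw [potential, potential, if_pos hu.2, if_neg hp, hu.1, Nat.sub_self] at this
  rw [WeightedTree.dist, ← hq]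
  change _ ≤ (q.edges.map (tree B K).length).sum + 1
  generalize (q.edges.map (tree B K).length).sum = s at this
  zify
  rw [pow_succ]
  linarith

end TreeNode

/-! ### Random demand sequences -/

/-- A finitely supported distribution on demand sequences, as a list of weighted sequences. That
the weights add up to `1` is not part of the definition. -/
abbrev RandomInput (V : Type*) := List (ℝ≥0 × List V)

namespace RandomInput

variable {V ι : Type*}

/-- The expected value of `F`. -/
noncomputable def expect (D : RandomInput V) (F : List V → ℝ) : ℝ :=
  (D.map fun d => (d.1 : ℝ) * F d.2).sum

lemma expect_mono {D : RandomInput V} {F G : List V → ℝ} (h : ∀ d ∈ D, F d.2 ≤ G d.2) :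
    D.expect F ≤ D.expect G :=
  List.sum_le_sum fun d hd => mul_le_mul_of_nonneg_left (h d hd) d.1.2

lemma expect_add (D : RandomInput V) (F G : List V → ℝ) :
    (D.expect fun σ => F σ + G σ) = D.expect F + D.expect G := by
  simp only [expect, mul_add, List.sum_map_add]

lemma expect_const_mul (D : RandomInput V) (a : ℝ) (F : List V → ℝ) :
    (D.expect fun σ => a * F σ) = a * D.expect F := by
  simp only [expect, mul_left_comm _ a, List.sum_map_mul_left]

/-- Visit the members of a list in turn, appending a sample of `D c` for each visited `c`, and stop
with probability `1 / 2` after each visit. -/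
noncomputable def visit (D : ι → RandomInput V) : List ι → RandomInput V
  | [] => [(1, [])]
  | c :: cs => (D c).flatMap fun d =>
      (d.1 / 2, d.2) :: (visit D cs).map fun e => (d.1 / 2 * e.1, d.2 ++ e.2)

@[simp]
lemma expect_visit_nil (D : ι → RandomInput V) (F : List V → ℝ) :
    (visit D []).expect F = F [] := by
  simp [visit, expect]

lemma expect_visit_cons (D : ι → RandomInput V) (c : ι) (cs : List ι) (F : List V → ℝ) :
    (visit D (c :: cs)).expect F =
      (D c).expect fun σ => F σ / 2 + (visit D cs).expect (fun τ => F (σ ++ τ)) / 2 := by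
  have key : ∀ D' : RandomInput V, expect (D'.flatMap fun d =>
      (d.1 / 2, d.2) :: (visit D cs).map fun e => (d.1 / 2 * e.1, d.2 ++ e.2)) F =
      D'.expect fun σ => F σ / 2 + (visit D cs).expect (fun τ => F (σ ++ τ)) / 2 := by
    intro D'
    induction D' with
    | nil => simp [expect]
    | cons d D' ih =>
      simp only [expect] at ih
      simp only [expect, List.flatMap_cons, List.map_append, List.sum_append, List.map_cons,
        List.sum_cons, ih, List.map_map, Function.comp_def, NNReal.coe_mul, NNReal.coe_div,
        NNReal.coe_ofNat, mul_assoc, List.sum_map_mul_left]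
      ring
  exact key (D c)

/-- The total weight of `D` is `1`. -/
def IsProb (D : RandomInput V) : Prop := ∀ a : ℝ, (D.expect fun _ => a) = a

lemma isProb_visit {D : ι → RandomInput V} (hD : ∀ c, (D c).IsProb) (cs : List ι) :
    (visit D cs).IsProb := by
  intro a
  induction cs with
  | nil => simp
  | cons c cs ih => rw [expect_visit_cons, ih, hD c]; ring

lemma of_mem_of_mem_visit {D : ι → RandomInput V} {P : V → Prop}
    (hD : ∀ c, ∀ d ∈ D c, ∀ x ∈ d.2, P x) (cs : List ι) : ∀ d ∈ visit D cs, ∀ x ∈ d.2, P x := by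
  induction cs with
  | nil => simp [visit]
  | cons c cs ih =>
    intro d hd x hx
    rw [visit, List.mem_flatMap] at hd
    obtain ⟨d', hd', hd⟩ := hd
    rw [List.mem_cons, List.mem_map] at hd
    rcases hd with rfl | ⟨e, he, rfl⟩
    · exact hD c _ hd' x hx
    · rcases List.mem_append.1 hx with hx | hx
      · exact hD c _ hd' x hx
      · exact ih _ he x hx

lemma length_le_of_mem_visit {D : ι → RandomInput V} {m : ℕ}
    (hD : ∀ c, ∀ d ∈ D c, d.2.length ≤ m) (cs : List ι) :
    ∀ d ∈ visit D cs, d.2.length ≤ cs.length * m := by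
  induction cs with
  | nil => simp [visit]
  | cons c cs ih =>
    intro d hd
    rw [visit, List.mem_flatMap] at hd
    obtain ⟨d', hd', hd⟩ := hd
    rw [List.mem_cons, List.mem_map] at hd
    have h1 := hD c _ hd'
    rw [List.length_cons, add_mul, one_mul]
    rcases hd with rfl | ⟨e, he, rfl⟩
    · simp only
      omega
    · have h2 := ih _ he
      simp only [List.length_append]
      omega

lemma ne_nil_of_mem_visit {D : ι → RandomInput V} (hD : ∀ c, ∀ d ∈ D c, d.2 ≠ []) {cs : List ι}
    (hcs : cs ≠ []) : ∀ d ∈ visit D cs, d.2 ≠ [] := by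
  intro d hd
  obtain ⟨c, cs, rfl⟩ := List.exists_cons_of_ne_nil hcs
  rw [visit, List.mem_flatMap] at hd
  obtain ⟨d', hd', hd⟩ := hd
  rw [List.mem_cons, List.mem_map] at hd
  rcases hd with rfl | ⟨e, he, rfl⟩
  · exact hD c d' hd'
  · simp [hD c _ hd']

/-- The expected number of visits of `visit` to a list of length `k`. -/
noncomputable def meanVisits (k : ℕ) : ℝ := 2 - 2 / 2 ^ k

lemma meanVisits_succ (k : ℕ) : meanVisits (k + 1) = 1 + meanVisits k / 2 := by
  rw [meanVisits, meanVisits, pow_succ]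
  field_simp
  ring

lemma meanVisits_nonneg (k : ℕ) : 0 ≤ meanVisits k := by
  rw [meanVisits, sub_nonneg, div_le_iff₀ (by positivity)]
  linarith [one_le_pow₀ (n := k) (one_le_two (α := ℝ))]

lemma meanVisits_le_two (k : ℕ) : meanVisits k ≤ 2 := by
  rw [meanVisits, sub_le_self_iff]
  positivity

open Classical in
/-- Suppose that, whatever the history, the visit to `c` makes the spending `s c` at least `X` on
average unless an insurance `I` is held. By the memorylessness of the stopping rule, once the
insurance is taken the expected number of visits still to come is at most the one at the outset.
Hence the total spending, with a price of `X` per visit expected at the outset for the insurance,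
is at least `X` per expected visit. -/
lemma le_expect_visit {D : ι → RandomInput V} (hprob : ∀ c, (D c).IsProb)
    {s : ι → List V → ℝ} (hs0 : ∀ c h, 0 ≤ s c h) (hs : ∀ c h σ, s c h ≤ s c (h ++ σ))
    {I : List V → Prop} (hI : ∀ h σ, I h → I (h ++ σ)) {X : ℝ} (hX : 0 ≤ X)
    (hD : ∀ c h, X ≤ (D c).expect fun σ => s c (h ++ σ) + if I (h ++ σ) then X else 0)
    (cs : List ι) : ∀ h, meanVisits cs.length * X ≤ (visit D cs).expect fun σ =>
      (cs.map fun c => s c (h ++ σ)).sum +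
        if I (h ++ σ) then meanVisits cs.length * X else 0 := by
  induction cs with
  | nil => intro h; simp [meanVisits]
  | cons c cs ih =>
    intro h
    rw [expect_visit_cons, List.length_cons, meanVisits_succ]
    set e := meanVisits cs.length with he
    have he0 : 0 ≤ e := meanVisits_nonneg _
    have he2 : e ≤ 2 := meanVisits_le_two _
    have hsum : ∀ h, 0 ≤ (cs.map fun c => s c h).sum := fun h =>
      List.sum_nonneg (by simpa using fun c _ => hs0 c h)
    have hP : (visit D cs).IsProb := isProb_visit hprob cs
    have heX : 0 ≤ (1 + e / 2) * X := by positivity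
    have step : ∀ σ, s c (h ++ σ) + (if I (h ++ σ) then X else 0) + e / 2 * X ≤
        (((c :: cs).map fun c => s c (h ++ σ)).sum +
          if I (h ++ σ) then (1 + e / 2) * X else 0) / 2 +
        ((visit D cs).expect fun τ => ((c :: cs).map fun c => s c (h ++ (σ ++ τ))).sum +
          if I (h ++ (σ ++ τ)) then (1 + e / 2) * X else 0) / 2 := by
      intro σ
      have h1 := hsum (h ++ σ)
      simp only [List.map_cons, List.sum_cons]
      by_cases hIσ : I (h ++ σ)
      · have h2 : s c (h ++ σ) + (1 + e / 2) * X ≤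
            (visit D cs).expect fun τ => s c (h ++ (σ ++ τ)) +
              (cs.map fun c => s c (h ++ (σ ++ τ))).sum +
              if I (h ++ (σ ++ τ)) then (1 + e / 2) * X else 0 := by
          rw [← hP (s c (h ++ σ) + (1 + e / 2) * X)]
          refine expect_mono fun d _ => ?_
          have h3 := hs c (h ++ σ) d.2
          have h4 := hI _ d.2 hIσ
          rw [List.append_assoc] at h3 h4
          rw [if_pos h4]
          linarith [hsum (h ++ (σ ++ d.2))]
        rw [if_pos hIσ, if_pos hIσ]
        linarith
      · have h2 : s c (h ++ σ) + e * X ≤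
            (visit D cs).expect fun τ => s c (h ++ (σ ++ τ)) +
              (cs.map fun c => s c (h ++ (σ ++ τ))).sum +
              if I (h ++ (σ ++ τ)) then (1 + e / 2) * X else 0 := by
          have h5 := ih (h ++ σ)
          have h6 := hP (s c (h ++ σ))
          calc s c (h ++ σ) + e * X ≤ (visit D cs).expect (fun _ => s c (h ++ σ)) +
                (visit D cs).expect (fun τ => (cs.map fun c => s c (h ++ σ ++ τ)).sum +
                  if I (h ++ σ ++ τ) then e * X else 0) := by rw [h6]; linarith
            _ ≤ _ := by
              rw [← expect_add]
              refine expect_mono fun d _ => ?_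
              have h3 := hs c (h ++ σ) d.2
              rw [List.append_assoc] at h3 ⊢
              split_ifs
              · have : e * X ≤ (1 + e / 2) * X := by
                  apply mul_le_mul_of_nonneg_right _ hX
                  linarith
                linarith
              · linarith
        rw [if_neg hIσ, if_neg hIσ]
        linarith
    calc (1 + e / 2) * X ≤ ((D c).expect fun σ => s c (h ++ σ) + if I (h ++ σ) then X else 0) +
          (D c).expect fun _ => e / 2 * X := by
            rw [hprob c]; linarith [hD c h]
      _ ≤ _ := by
        rw [← expect_add]
        exact expect_mono fun d _ => step d.2

/-- Suppose that each visit increases `g` by at most `y` on average, and that `g ≤ Z` at all times.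
With probability `2⁻ᵏ` the process visits all `k` members of the list and does not stop after the
last one either; then bound the final value by `Z`. Otherwise, sum the increments over the visits,
of which there are `2 - (k + 2) / 2ᵏ` in expectation in this case. -/
lemma expect_visit_le {D : ι → RandomInput V} (hprob : ∀ c, (D c).IsProb) {g : List V → ℝ}
    {y Z : ℝ} (hD : ∀ c h, ((D c).expect fun σ => g (h ++ σ)) ≤ g h + y) {P : List V → Prop}
    (hP : ∀ h, P h → ∀ c, ∀ d ∈ D c, P (h ++ d.2)) (hZ : ∀ h, P h → g h ≤ Z) (cs : List ι) :
    ∀ h, P h → ((visit D cs).expect fun σ => g (h ++ σ)) ≤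
      1 / 2 ^ cs.length * Z + (1 - 1 / 2 ^ cs.length) * g h +
        (2 - (cs.length + 2) / 2 ^ cs.length) * y := by
  induction cs with
  | nil => intro h hh; simpa using hZ h hh
  | cons c cs ih =>
    intro h hh
    rw [expect_visit_cons, List.length_cons]
    set a : ℝ := 1 / 2 ^ cs.length with ha
    have ha0 : 0 ≤ a := by positivity
    have ha1 : a ≤ 1 := by
      rw [ha, div_le_one (by positivity)]
      exact one_le_pow₀ one_le_two
    have h1 : ((D c).expect fun σ => g (h ++ σ) / 2 +
          (visit D cs).expect (fun τ => g (h ++ (σ ++ τ))) / 2) ≤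
        (D c).expect fun σ => (1 - a / 2) * g (h ++ σ) +
          (a / 2 * Z + (2 - (cs.length + 2) * a) * y / 2) := by
      refine expect_mono fun d hd => ?_
      have h2 := ih _ (hP h hh c d hd)
      simp only [List.append_assoc] at h2
      have h3 : ((cs.length : ℝ) + 2) / 2 ^ cs.length = (cs.length + 2) * a := by
        rw [ha]; ring
      rw [h3] at h2
      linarith
    refine h1.trans ?_
    rw [expect_add, expect_const_mul, hprob c]
    have h4 : (1 - a / 2) * ((D c).expect fun σ => g (h ++ σ)) ≤ (1 - a / 2) * (g h + y) :=
      mul_le_mul_of_nonneg_left (hD c h) (by linarith)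
    have h5 : (1 : ℝ) / 2 ^ (cs.length + 1) = a / 2 := by rw [ha, pow_succ]; ring
    have h6 : (((cs.length + 1 : ℕ) : ℝ) + 2) / 2 ^ (cs.length + 1) =
        (cs.length + 3) * (a / 2) := by
      rw [← h5]; push_cast; ring
    rw [h5, h6]
    linarith

end RandomInput

namespace TreeNode

open RandomInput SumRadii

variable {B K : ℕ}

/-- The random demand sequence in the subtree of a node of height `j`: at height `0` the leaf
itself, and otherwise the subtrees of the children are visited in turn, with a stop with probability
`1 / 2` after each of them. -/
noncomputable def randomInput : ℕ → TreeNode B K → RandomInput (TreeNode B K)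
  | 0, v => [(1, [v])]
  | j + 1, v => visit (fun c => randomInput j (v.child c)) (List.finRange B)

lemma isProb_randomInput (j : ℕ) : ∀ v : TreeNode B K, (randomInput j v).IsProb := by
  induction j with
  | zero => intro v a; simp [randomInput, expect]
  | succ j ih => intro v; exact isProb_visit (fun c => ih _) _

lemma length_le_of_mem_randomInput (j : ℕ) : ∀ v : TreeNode B K, ∀ d ∈ randomInput j v,
    d.2.length ≤ B ^ j := by
  induction j with
  | zero => simp [randomInput]
  | succ j ih =>
    intro v d hd
    have := length_le_of_mem_visit (fun c => ih _) _ d hd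
    rwa [List.length_finRange, ← pow_succ'] at this

lemma ne_nil_of_mem_randomInput (hB : 0 < B) (j : ℕ) : ∀ v : TreeNode B K, ∀ d ∈ randomInput j v,
    d.2 ≠ [] := by
  induction j with
  | zero => simp [randomInput]
  | succ j ih =>
    intro v
    refine ne_nil_of_mem_visit (fun c => ih _) fun h => ?_
    have := congrArg List.length h
    simp at this
    omega

lemma length_child {v : TreeNode B K} {j : ℕ} (hv : v.1.length + (j + 1) = K) (c : Fin B) :
    (v.child c).1.length + j = K := by
  rw [child_val (by omega), List.length_cons]
  omega

lemma isLeafBelow_of_mem_randomInput (j : ℕ) : ∀ v : TreeNode B K, v.1.length + j = K →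
    ∀ d ∈ randomInput j v, ∀ x ∈ d.2, IsLeafBelow v x := by
  induction j with
  | zero =>
    intro v hv d hd x hx
    rw [randomInput, List.mem_singleton] at hd
    subst hd
    rw [List.mem_singleton.1 hx]
    exact ⟨hv, List.suffix_rfl⟩
  | succ j ih =>
    intro v hv
    refine of_mem_of_mem_visit (fun c d hd x hx => ?_) _
    exact (ih _ (length_child hv c) d hd x hx).of_child (by omega)

/-! ### Lower bound on the cost of an online algorithm -/

/-- The cluster costs at least `2 ^ j`, where `j` is the height of `v`, and its center lies below
each ancestor `w` of `v` (`v` included) whose height `i` satisfies `1 + C.radius < 2 ^ (i + 1)`.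
The second condition is necessary for covering any leaf below `v`, see `dominates_of_covers`. -/
def Dominates (v : TreeNode B K) (C : Cluster (TreeNode B K)) : Prop :=
  2 ^ (K - v.1.length) ≤ 1 + C.radius ∧
    ∀ w : TreeNode B K, w.1 <:+ v.1 → 1 + C.radius < 2 ^ (K - w.1.length + 1) → w.1 <:+ C.center.1

/-- The center of the cluster lies in the subtree of `v`, and the cluster is too cheap to cover
more than this subtree. -/
def Inside (v : TreeNode B K) (C : Cluster (TreeNode B K)) : Prop :=
  v.1 <:+ C.center.1 ∧ 1 + C.radius < 2 ^ (K - v.1.length + 1)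

lemma dominates_of_covers {u : TreeNode B K} (hu : u.1.length = K) {C : Cluster (TreeNode B K)}
    (hC : C.Covers (tree B K).dist u) : Dominates u C := by
  refine ⟨by simp [hu], fun w hw hlt => ?_⟩
  by_contra hc
  refine hlt.not_ge ?_
  have h1 := le_dist_add_one ⟨hu, hw⟩ hc
  have h2 : ((tree B K).dist C.center u : ℝ≥0) ≤ C.radius := hC
  calc (2 : ℝ≥0) ^ (K - w.1.length + 1) ≤ (tree B K).dist C.center u + 1 := by exact_mod_cast h1
    _ ≤ 1 + C.radius := by rw [add_comm]; gcongr

lemma Dominates.inside_or_le {v : TreeNode B K} {C : Cluster (TreeNode B K)} (h : Dominates v C) :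
    Inside v C ∨ 2 ^ (K - v.1.length + 1) ≤ 1 + C.radius := by
  by_cases hlt : 1 + C.radius < 2 ^ (K - v.1.length + 1)
  · exact Or.inl ⟨h.2 v List.suffix_rfl hlt, hlt⟩
  · exact Or.inr (not_lt.1 hlt)

lemma height_child {v : TreeNode B K} (h : v.1.length < K) (c : Fin B) :
    K - (v.child c).1.length + 1 = K - v.1.length := by
  rw [child_val h, List.length_cons]
  omega

lemma Dominates.of_child {v : TreeNode B K} (hv : v.1.length < K) {c : Fin B}
    {C : Cluster (TreeNode B K)} (h : Dominates (v.child c) C) :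
    Inside (v.child c) C ∨ Dominates v C := by
  refine h.inside_or_le.imp_right fun h1 => ⟨height_child hv c ▸ h1, fun w hw => h.2 w ?_⟩
  rw [child_val hv]
  exact hw.trans (List.suffix_cons _ _)

lemma Inside.of_child {v : TreeNode B K} (hv : v.1.length < K) {c : Fin B}
    {C : Cluster (TreeNode B K)} (h : Inside (v.child c) C) : Inside v C := by
  refine ⟨?_, h.2.trans_le ?_⟩
  · have := h.1
    rw [child_val hv] at this
    exact (List.suffix_cons _ _).trans this
  · rw [height_child hv]
    exact pow_le_pow_right₀ one_le_two (Nat.le_succ _)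

lemma Inside.child_unique {v : TreeNode B K} (hv : v.1.length < K) {c c' : Fin B}
    {C : Cluster (TreeNode B K)} (h : Inside (v.child c) C) (h' : Inside (v.child c') C) :
    c = c' := by
  have h1 := h.1
  have h2 := h'.1
  rw [child_val hv] at h1 h2
  have h3 := (List.suffix_of_suffix_length_le h1 h2 (by simp)).eq_of_length (by simp)
  exact (List.cons.inj h3).1

open Classical in
/-- The part of the cost of the cluster that is charged to the subtree of `v`. -/
noncomputable def charge (v : TreeNode B K) (C : Cluster (TreeNode B K)) : ℝ :=
  if Inside v C then 1 + (C.radius : ℝ) else 0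

lemma charge_nonneg (v : TreeNode B K) (C : Cluster (TreeNode B K)) : 0 ≤ charge v C := by
  unfold charge
  split_ifs <;> positivity

lemma charge_le (v : TreeNode B K) (C : Cluster (TreeNode B K)) :
    charge v C ≤ 1 + (C.radius : ℝ) := by
  unfold charge
  split_ifs
  · exact le_rfl
  · positivity

lemma sum_charge_child_le {v : TreeNode B K} (hv : v.1.length < K) (C : Cluster (TreeNode B K)) :
    ∑ c, charge (v.child c) C ≤ charge v C := by
  by_cases h : ∃ c, Inside (v.child c) C
  · obtain ⟨c, hc⟩ := h
    rw [Finset.sum_eq_single c]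
    · rw [charge, charge, if_pos hc, if_pos (hc.of_child hv)]
    · intro c' _ hne
      rw [charge, if_neg]
      exact fun h' => hne (h'.child_unique hv hc)
    · simp
  · push Not at h
    rw [Finset.sum_eq_zero fun c _ => by rw [charge, if_neg (h c)]]
    exact charge_nonneg _ _

lemma sum_charge_child_add_le {v : TreeNode B K} (hv : v.1.length < K)
    {C : Cluster (TreeNode B K)} (hin : Inside v C) (hdom : Dominates v C) :
    ∑ c, charge (v.child c) C + 2 ^ (K - v.1.length) ≤ charge v C := by
  have h1 : ∀ c, charge (v.child c) C = 0 := fun c => by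
    rw [charge, if_neg]
    intro h
    have := h.2
    rw [height_child hv] at this
    exact this.not_ge hdom.1
  rw [Finset.sum_eq_zero fun c _ => h1 c, zero_add, charge, if_pos hin]
  exact_mod_cast hdom.1

/-- The total cost of the clusters in `L` that is charged to the subtree of `v`. -/
noncomputable def spent (v : TreeNode B K) (L : List (Cluster (TreeNode B K))) : ℝ :=
  (L.map (charge v)).sum

lemma spent_nonneg (v : TreeNode B K) (L : List (Cluster (TreeNode B K))) : 0 ≤ spent v L :=
  List.sum_nonneg (by simpa using fun C _ => charge_nonneg v C)

lemma spent_mono (v : TreeNode B K) {L L' : List (Cluster (TreeNode B K))} (h : L <+: L') :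
    spent v L ≤ spent v L' := by
  obtain ⟨M, rfl⟩ := h
  have := spent_nonneg v M
  rw [spent] at this ⊢
  rw [spent, List.map_append, List.sum_append]
  linarith

lemma sum_spent_child_eq (v : TreeNode B K) (L : List (Cluster (TreeNode B K))) :
    ((List.finRange B).map fun c => spent (v.child c) L).sum =
      (L.map fun C => ∑ c, charge (v.child c) C).sum := by
  rw [← List.ofFn_eq_map, List.sum_ofFn]
  induction L with
  | nil => simp [spent]
  | cons C L ih =>
    simp only [spent, List.map_cons, List.sum_cons, Finset.sum_add_distrib] at ih ⊢
    rw [ih]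

lemma sum_spent_child_le {v : TreeNode B K} (hv : v.1.length < K)
    (L : List (Cluster (TreeNode B K))) :
    ((List.finRange B).map fun c => spent (v.child c) L).sum ≤ spent v L := by
  rw [sum_spent_child_eq]
  exact List.sum_le_sum fun C _ => sum_charge_child_le hv C

lemma sum_spent_child_add_le {v : TreeNode B K} (hv : v.1.length < K)
    {L : List (Cluster (TreeNode B K))} {C : Cluster (TreeNode B K)} (hC : C ∈ L)
    (hin : Inside v C) (hdom : Dominates v C) :
    ((List.finRange B).map fun c => spent (v.child c) L).sum + 2 ^ (K - v.1.length) ≤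
      spent v L := by
  obtain ⟨L₁, L₂, rfl⟩ := List.append_of_mem hC
  rw [sum_spent_child_eq, spent]
  simp only [List.map_append, List.map_cons, List.sum_append, List.sum_cons]
  have h1 := List.sum_le_sum (l := L₁) fun C _ => sum_charge_child_le hv C
  have h2 := List.sum_le_sum (l := L₂) fun C _ => sum_charge_child_le hv C
  have h3 := sum_charge_child_add_le hv hin hdom
  linarith

open Classical in
/-- Lower bound for the spending in the subtree of a node of height `j`. It holds for every
history, provided that a cluster satisfying `A` is credited; here `A` holds for the clusters that
are useful below `v` but not charged to this subtree. -/
theorem le_expect_spent {S : List (TreeNode B K) → List (Cluster (TreeNode B K))}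
    (hS : ∀ h σ, S h <+: S (h ++ σ))
    (hcov : ∀ h u, ∃ C ∈ S (h ++ [u]), C.Covers (tree B K).dist u) (j : ℕ) :
    ∀ v : TreeNode B K, v.1.length + j = K → ∀ A : Cluster (TreeNode B K) → Prop,
      (∀ C, Dominates v C → Inside v C ∨ A C) → ∀ h, meanVisits B ^ j ≤
        (randomInput j v).expect fun σ => spent v (S (h ++ σ)) +
          if ∃ C ∈ S (h ++ σ), A C then meanVisits B ^ j else 0 := by
  induction j with
  | zero =>
    intro v hv A hA h
    obtain ⟨C, hC, hcovC⟩ := hcov h v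
    simp only [randomInput, expect, List.map_cons, List.map_nil, List.sum_cons, List.sum_nil,
      pow_zero, NNReal.coe_one, one_mul, add_zero]
    rcases hA C (dominates_of_covers hv hcovC) with hin | hAC
    · have h1 : charge v C ≤ spent v (S (h ++ [v])) :=
        List.single_le_sum (by simpa using fun C _ => charge_nonneg v C) _
          (List.mem_map_of_mem hC)
      rw [charge, if_pos hin] at h1
      have h2 : (0 : ℝ) ≤ C.radius := C.radius.2
      have h3 : (0 : ℝ) ≤ if ∃ C ∈ S (h ++ [v]), A C then 1 else 0 := by
        split_ifs <;> norm_num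
      linarith
    · rw [if_pos ⟨C, hC, hAC⟩]
      linarith [spent_nonneg v (S (h ++ [v]))]
  | succ j ih =>
    intro v hv A hA h
    have hv' : v.1.length < K := by omega
    have hB := meanVisits_nonneg B
    have key := le_expect_visit (D := fun c => randomInput j (v.child c))
      (s := fun c h => spent (v.child c) (S h)) (I := fun h => ∃ C ∈ S h, Dominates v C)
      (fun c => isProb_randomInput j _) (fun c h => spent_nonneg _ _)
      (fun c h σ => spent_mono _ (hS h σ))
      (fun h σ ⟨C, hC, hd⟩ => ⟨C, (hS h σ).subset hC, hd⟩) (pow_nonneg hB j)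
      (fun c h => by convert ih _ (length_child hv c) _ (fun C => Dominates.of_child hv') h)
      (List.finRange B) h
    rw [List.length_finRange, ← pow_succ'] at key
    refine key.trans (expect_mono fun d _ => ?_)
    have hX : meanVisits B ^ (j + 1) ≤ 2 ^ (K - v.1.length) := by
      rw [show K - v.1.length = j + 1 by omega]
      exact pow_le_pow_left₀ hB (meanVisits_le_two B) _
    have hX0 : 0 ≤ meanVisits B ^ (j + 1) := pow_nonneg hB _
    have h1 := sum_spent_child_le hv' (S (h ++ d.2))
    by_cases hAC : ∃ C ∈ S (h ++ d.2), A C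
    · rw [if_pos hAC]
      split_ifs <;> linarith
    · rw [if_neg hAC]
      split_ifs with hd
      · obtain ⟨C, hC, hd⟩ := hd
        have hin : Inside v C := (hA C hd).resolve_right fun h => hAC ⟨C, hC, h⟩
        linarith [sum_spent_child_add_le hv' hC hin hd]
      · linarith

lemma clustersOf_isPrefix {V : Type*} (respond : List V → List (Cluster V)) (h σ : List V) :
    clustersOf respond h <+: clustersOf respond (h ++ σ) := by
  rw [clustersOf, clustersOf, List.length_append, List.range_add, List.flatMap_append]
  refine ⟨_, congrArg (· ++ _) ?_⟩
  refine List.flatMap_congr fun i hi => ?_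
  rw [List.take_append_of_le_length]
  have := List.mem_range.1 hi
  omega

lemma coe_totalCost {V : Type*} (L : List (Cluster V)) :
    ((totalCost 1 L : ℝ≥0) : ℝ) = (L.map fun C => 1 + (C.radius : ℝ)).sum := by
  rw [totalCost, NNReal.coe_list_sum, List.map_map]
  rfl

theorem le_expect_cost (A : OnlineAlgorithm (tree B K).dist) :
    meanVisits B ^ K ≤ (randomInput K root).expect fun σ => (A.cost 1 σ : ℝ) := by
  refine (le_expect_spent (clustersOf_isPrefix A.respond) A.covers K root (by simp [root])
    (fun C => 2 ^ (K + 1) ≤ 1 + C.radius)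
    (fun C hC => by simpa [root] using hC.inside_or_le) []).trans
    (expect_mono fun d _ => ?_)
  rw [List.nil_append, OnlineAlgorithm.cost, coe_totalCost]
  set L := clustersOf A.respond d.2
  split_ifs with h
  · obtain ⟨C, hC, hCA⟩ := h
    have hX : meanVisits B ^ K ≤ 2 ^ (K + 1) :=
      (pow_le_pow_left₀ (meanVisits_nonneg B) (meanVisits_le_two B) K).trans
        (pow_le_pow_right₀ one_le_two (Nat.le_succ K))
    -- the cluster `C` is too expensive to be charged to the subtree of the root
    have h0 : charge root C = 0 := by
      rw [charge, if_neg]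
      exact fun h => h.2.not_ge (by simpa [root] using hCA)
    have hCA' : (2 : ℝ) ^ (K + 1) ≤ 1 + (C.radius : ℝ) := by exact_mod_cast hCA
    obtain ⟨L₁, L₂, hL⟩ := List.append_of_mem hC
    rw [spent, hL]
    simp only [List.map_append, List.map_cons, List.sum_append, List.sum_cons]
    have h1 := List.sum_le_sum (l := L₁) fun C _ => charge_le root C
    have h2 := List.sum_le_sum (l := L₂) fun C _ => charge_le root C
    linarith
  · rw [add_zero]
    exact List.sum_le_sum fun C _ => charge_le root C

/-! ### Upper bound on the optimal cost -/

lemma opt_le_of_subset {V : Type*} {d : V → V → ℕ} {f : ℝ≥0} {σ τ : List V} (h : σ ⊆ τ)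
    (hτ : ∃ S : List (Cluster V), ∀ u ∈ τ, ∃ C ∈ S, C.Covers d u) : opt d f σ ≤ opt d f τ := by
  obtain ⟨S, hS⟩ := hτ
  refine le_csInf ⟨_, S, hS, rfl⟩ ?_
  rintro x ⟨S, hS, rfl⟩
  exact csInf_le (OrderBot.bddBelow _) ⟨S, fun u hu => hS u (h hu), rfl⟩

lemma exists_cover {V : Type*} (d : V → V → ℕ) (σ : List V) :
    ∃ S : List (Cluster V), ∀ u ∈ σ, ∃ C ∈ S, C.Covers d u :=
  ⟨σ.map fun u => ⟨u, d u u⟩, fun _ hu => ⟨_, List.mem_map_of_mem hu, le_rfl⟩⟩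

lemma opt_append_le {V : Type*} {d : V → V → ℕ} {f : ℝ≥0} {σ τ : List V} {C : Cluster V}
    (hC : ∀ u ∈ τ, C.Covers d u) : opt d f (σ ++ τ) ≤ opt d f σ + (f + C.radius) := by
  rw [← tsub_le_iff_right]
  obtain ⟨S, hS⟩ := exists_cover d σ
  refine le_csInf ⟨_, S, hS, rfl⟩ ?_
  rintro x ⟨S, hS, rfl⟩
  rw [tsub_le_iff_right]
  refine csInf_le (OrderBot.bddBelow _) ⟨C :: S, fun u hu => ?_, ?_⟩
  · rcases List.mem_append.1 hu with hu | hu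
    · obtain ⟨C', hC', h⟩ := hS u hu
      exact ⟨C', List.mem_cons_of_mem _ hC', h⟩
    · exact ⟨C, List.mem_cons_self, hC u hu⟩
  · simp [totalCost, add_comm]

lemma opt_nil {V : Type*} (d : V → V → ℕ) (f : ℝ≥0) : opt d f [] = 0 :=
  le_antisymm (csInf_le (OrderBot.bddBelow _) ⟨[], by simp, by simp [totalCost]⟩) zero_le

/-- Leaves below a node of height `j` can be covered at cost `2 ^ j`. -/
lemma opt_append_le_of_isLeafBelow {v : TreeNode B K} {σ τ : List (TreeNode B K)}
    (hτ : ∀ u ∈ τ, IsLeafBelow v u) :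
    (opt (tree B K).dist 1 (σ ++ τ) : ℝ) ≤
      opt (tree B K).dist 1 σ + 2 ^ (K - v.1.length) := by
  have h1 : (1 : ℝ≥0) ≤ 2 ^ (K - v.1.length) := one_le_pow₀ one_le_two
  have h := opt_append_le (d := (tree B K).dist) (f := 1) (σ := σ) (τ := τ)
    (C := ⟨v, 2 ^ (K - v.1.length) - 1⟩) fun u hu => by
      rw [Cluster.Covers, le_tsub_iff_right h1]
      exact_mod_cast dist_add_one_le_of_isLeafBelow (hτ u hu)
  rw [add_tsub_cancel_of_le h1] at h
  exact_mod_cast h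

/-- An upper bound for the expected optimal cost in the subtree of a node of height `j`, relative
to the cost `2 ^ j` of covering the entire subtree. -/
noncomputable def optRatio (B : ℕ) : ℕ → ℝ
  | 0 => 1
  | j + 1 => 1 / 2 ^ B + (2 - (B + 2) / 2 ^ B) / 2 * optRatio B j

theorem expect_opt_le (j : ℕ) : ∀ v : TreeNode B K, v.1.length + j = K → ∀ h,
    ((randomInput j v).expect fun σ => (opt (tree B K).dist 1 (h ++ σ) : ℝ)) ≤
      opt (tree B K).dist 1 h + 2 ^ j * optRatio B j := by
  induction j with
  | zero =>
    intro v hv h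
    have hb : IsLeafBelow v v := ⟨hv, List.suffix_rfl⟩
    have := opt_append_le_of_isLeafBelow (σ := h) (τ := [v]) (v := v) (by simpa using hb)
    rw [add_zero] at hv
    simpa [randomInput, expect, optRatio, hv] using this
  | succ j ih =>
    intro v hv h
    have key := expect_visit_le (D := fun c => randomInput j (v.child c))
      (g := fun h => (opt (tree B K).dist 1 h : ℝ))
      (P := fun h' => ∃ τ, h' = h ++ τ ∧ ∀ u ∈ τ, IsLeafBelow v u)
      (Z := opt (tree B K).dist 1 h + 2 ^ (K - v.1.length))
      (fun c => isProb_randomInput j _) (fun c h => ih _ (length_child hv c) h)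
      (by
        rintro _ ⟨τ, rfl, hτ⟩ c d hd
        refine ⟨τ ++ d.2, List.append_assoc _ _ _, fun u hu => ?_⟩
        rcases List.mem_append.1 hu with hu | hu
        · exact hτ u hu
        · exact (isLeafBelow_of_mem_randomInput j _ (length_child hv c) d hd u hu).of_child
            (by omega))
      (by
        rintro _ ⟨τ, rfl, hτ⟩
        exact opt_append_le_of_isLeafBelow hτ)
      (List.finRange B) h ⟨[], by simp, by simp⟩
    rw [List.length_finRange, show K - v.1.length = j + 1 by omega] at key
    refine key.trans (le_of_eq ?_)
    rw [optRatio]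
    ring

/-- The recursion contracts to its fixed point `2 / (B + 2)` at a rate that makes `2 ^ B` steps
sufficient to get within a constant factor of it. -/
lemma optRatio_le (B : ℕ) : optRatio B (2 ^ B) ≤ 4 / (B + 2) := by
  set q : ℝ := (B + 2) / 2 / 2 ^ B with hq
  have hB : (0 : ℝ) < B + 2 := by positivity
  have hq1 : q ≤ 1 := by
    rw [hq, div_le_one (by positivity), div_le_iff₀ (by norm_num)]
    have h1 : B + 2 ≤ 2 ^ B * 2 := by
      have := Nat.lt_two_pow_self (n := B + 1)
      rw [pow_succ] at this
      omega
    exact_mod_cast h1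
  have hq0 : 0 < q := by positivity
  have hrec : ∀ j, optRatio B j - 2 / (B + 2) = (1 - q) ^ j * (1 - 2 / (B + 2)) := by
    intro j
    induction j with
    | zero => simp [optRatio]
    | succ j ih =>
      have : optRatio B (j + 1) - 2 / (B + 2) = (1 - q) * (optRatio B j - 2 / (B + 2)) := by
        rw [optRatio, hq]
        field_simp
        ring
      rw [this, ih, pow_succ]
      ring
  have hpow : (1 - q) ^ 2 ^ B ≤ 2 / (B + 2) := by
    have h1 : 1 + ((2 ^ B : ℕ) : ℝ) * q ≤ (1 + q) ^ 2 ^ B := one_add_mul_le_pow (by linarith) _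
    have h2 : ((2 ^ B : ℕ) : ℝ) * q = (B + 2) / 2 := by
      rw [hq]
      push_cast
      field_simp
    have h3 : (1 - q) ^ 2 ^ B * (1 + q) ^ 2 ^ B ≤ 1 := by
      rw [← mul_pow]
      apply pow_le_one₀
      · apply mul_nonneg <;> linarith
      · nlinarith
    have h4 : 0 ≤ (1 - q) ^ 2 ^ B := pow_nonneg (by linarith) _
    rw [le_div_iff₀ hB]
    have h5 : (1 - q) ^ 2 ^ B * ((B + 2) / 2) ≤ 1 := by
      refine le_trans (mul_le_mul_of_nonneg_left ?_ h4) h3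
      linarith
    linarith
  have h6 : (1 - q) ^ 2 ^ B * (1 - 2 / ((B : ℝ) + 2)) ≤ (1 - q) ^ 2 ^ B := by
    apply mul_le_of_le_one_right (pow_nonneg (by linarith) _)
    have : 0 ≤ 2 / ((B : ℝ) + 2) := by positivity
    linarith
  have h7 : (4 : ℝ) / (B + 2) = 2 / (B + 2) + 2 / (B + 2) := by ring
  linarith [hrec (2 ^ B)]

lemma le_meanVisits_pow {B : ℕ} (hB : 0 < B) : (2 : ℝ) ^ 2 ^ B / 4 ≤ meanVisits B ^ 2 ^ B := by
  obtain ⟨b, rfl⟩ := Nat.exists_eq_succ_of_ne_zero hB.ne'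
  -- Bernoulli's inequality for the square root of the power
  have h1 : 1 + ((2 ^ b : ℕ) : ℝ) * (-(1 / 2 ^ (b + 1))) ≤
      (1 + -(1 / 2 ^ (b + 1))) ^ 2 ^ b := by
    apply one_add_mul_le_pow
    have : (1 : ℝ) / 2 ^ (b + 1) ≤ 1 := by
      rw [div_le_one (by positivity)]
      exact one_le_pow₀ one_le_two
    linarith
  have h2 : 1 + ((2 ^ b : ℕ) : ℝ) * (-(1 / 2 ^ (b + 1))) = 1 / 2 := by
    push_cast
    rw [pow_succ]
    field_simp
    norm_num
  rw [h2] at h1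
  have h3 : meanVisits (b + 1) = 2 * (1 + -(1 / 2 ^ (b + 1))) := by
    rw [meanVisits]; ring
  have h4 := pow_le_pow_left₀ (by norm_num) h1 2
  rw [← pow_mul, ← pow_succ] at h4
  rw [h3, mul_pow, Nat.succ_eq_add_one]
  have h5 : (0 : ℝ) < 2 ^ 2 ^ (b + 1) := by positivity
  nlinarith

end TreeNode

/-! ### From average costs to the competitive ratio -/

namespace RandomInput

open SumRadii MeasureTheory

lemma ofReal_expect {V : Type*} (D : RandomInput V) (g : List V → ℝ≥0) :
    ENNReal.ofReal (D.expect fun σ => (g σ : ℝ)) = (D.map fun e => (e.1 : ℝ≥0∞) * g e.2).sum := by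
  have h : (D.expect fun σ => (g σ : ℝ)) = ((D.map fun e => e.1 * g e.2).sum : ℝ≥0) := by
    rw [expect, NNReal.coe_list_sum, List.map_map]
    rfl
  rw [h, ENNReal.ofReal_coe_nnreal]
  induction D with
  | nil => simp
  | cons e D ih =>
    have := ih (by rw [expect, NNReal.coe_list_sum, List.map_map]; rfl)
    simp [this]

lemma lintegral_sum_cost {V Ω : Type*} {d : V → V → ℕ} {f : ℝ≥0} [MeasurableSpace Ω]
    (P : Measure Ω) (A : RandomizedAlgorithm d f Ω) (D : RandomInput V) :
    ∫⁻ ω, (D.map fun e => (e.1 : ℝ≥0∞) * (A.alg ω).cost f e.2).sum ∂P =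
      (D.map fun e => (e.1 : ℝ≥0∞) * A.expectedCost P e.2).sum := by
  induction D with
  | nil => simp
  | cons e D ih =>
    have hm : Measurable fun ω => ((A.alg ω).cost f e.2 : ℝ≥0∞) :=
      (A.measurable_cost e.2).coe_nnreal_ennreal
    simp only [List.map_cons, List.sum_cons]
    rw [lintegral_add_left (hm.const_mul _), ih, lintegral_const_mul _ hm]
    rfl

/-- Yao's principle: if on a random input every deterministic algorithm pays at least `X` on
average, while the optimal cost is at most `Y` on average, then a `ρ`-competitive randomized
algorithm has `X ≤ ρ * Y`. -/
lemma le_mul_of_isCompetitive {V Ω : Type*} {d : V → V → ℕ} {f : ℝ≥0} [MeasurableSpace Ω]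
    {P : Measure Ω} [IsProbabilityMeasure P] {A : RandomizedAlgorithm d f Ω} {n : ℕ} {ρ : ℝ≥0∞}
    (hA : A.IsCompetitive P n ρ) {D : RandomInput V} (hD : ∀ e ∈ D, e.2.length = n) {X Y : ℝ}
    (hX : ∀ A : OnlineAlgorithm d, X ≤ D.expect fun σ => (A.cost f σ : ℝ))
    (hY : (D.expect fun σ => (opt d f σ : ℝ)) ≤ Y) :
    ENNReal.ofReal X ≤ ρ * ENNReal.ofReal Y := by
  calc ENNReal.ofReal X = ∫⁻ _, ENNReal.ofReal X ∂P := by simp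
    _ ≤ ∫⁻ ω, (D.map fun e => (e.1 : ℝ≥0∞) * (A.alg ω).cost f e.2).sum ∂P := by
      refine lintegral_mono fun ω => ?_
      rw [← ofReal_expect D fun σ => (A.alg ω).cost f σ]
      exact ENNReal.ofReal_le_ofReal (hX _)
    _ = (D.map fun e => (e.1 : ℝ≥0∞) * A.expectedCost P e.2).sum := lintegral_sum_cost P A D
    _ ≤ (D.map fun e => ρ * ((e.1 : ℝ≥0∞) * opt d f e.2)).sum := by
      refine List.sum_le_sum fun e he => ?_
      rw [mul_left_comm]
      gcongr
      exact hA _ (hD e he)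
    _ = ρ * ENNReal.ofReal (D.expect fun σ => (opt d f σ : ℝ)) := by
      rw [List.sum_map_mul_left, ofReal_expect]
    _ ≤ _ := by gcongr

end RandomInput

namespace SumRadii

lemma totalCost_mono_of_isPrefix {V : Type*} {f : ℝ≥0} {L L' : List (Cluster V)} (h : L <+: L') :
    totalCost f L ≤ totalCost f L' := by
  obtain ⟨M, rfl⟩ := h
  rw [totalCost, totalCost, List.map_append, List.sum_append]
  exact le_self_add

/-- Extend a demand sequence to length `n` by repeating its first demand. -/
def pad {V : Type*} (n : ℕ) (r : V) (σ : List V) : List V :=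
  σ ++ List.replicate (n - σ.length) (σ.headD r)

lemma length_pad {V : Type*} {n : ℕ} (r : V) {σ : List V} (h : σ.length ≤ n) :
    (pad n r σ).length = n := by
  rw [pad, List.length_append, List.length_replicate]
  omega

lemma pad_subset {V : Type*} (n : ℕ) (r : V) {σ : List V} (h : σ ≠ []) : pad n r σ ⊆ σ := by
  obtain ⟨a, σ, rfl⟩ := List.exists_cons_of_ne_nil h
  intro x hx
  rcases List.mem_append.1 hx with hx | hx
  · exact hx
  · rw [List.eq_of_mem_replicate hx]
    exact List.mem_cons_self

end SumRadii

open SumRadii RandomInput TreeNode in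
/-- The competitive ratio on the `B`-ary tree of depth `2 ^ B` is at least `(B + 2) / 16`. -/
theorem TreeNode.le_of_isCompetitive {B n : ℕ} (hB : 0 < B) (hn : B ^ 2 ^ B ≤ n) {Ω : Type*}
    [MeasurableSpace Ω] {P : MeasureTheory.Measure Ω} [MeasureTheory.IsProbabilityMeasure P]
    {A : RandomizedAlgorithm (tree B (2 ^ B)).dist 1 Ω} {ρ : ℝ≥0∞} (hA : A.IsCompetitive P n ρ) :
    ENNReal.ofReal ((B + 2) / 16) ≤ ρ := by
  set K := 2 ^ B with hK
  let D : RandomInput (TreeNode B K) :=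
    (randomInput K root).map fun e => (e.1, pad n root e.2)
  have hexp : ∀ F, D.expect F = (randomInput K root).expect fun σ => F (pad n root σ) := fun F => by
    simp [D, expect, Function.comp_def]
  have key := le_mul_of_isCompetitive hA (D := D) (X := 2 ^ K / 4) (Y := 2 ^ K * (4 / (B + 2)))
    (by
      intro e' he'
      obtain ⟨e, he, rfl⟩ := List.mem_map.1 he'
      exact length_pad _ ((length_le_of_mem_randomInput K _ e he).trans hn))
    (fun A => by
      rw [hexp]
      refine (le_meanVisits_pow hB).trans ((le_expect_cost A).trans (expect_mono fun e _ => ?_))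
      exact_mod_cast totalCost_mono_of_isPrefix (clustersOf_isPrefix _ _ _))
    (by
      rw [hexp]
      have h1 : ((randomInput K root).expect fun σ =>
            (opt (tree B K).dist 1 (pad n root σ) : ℝ)) ≤
          (randomInput K root).expect fun σ => (opt (tree B K).dist 1 ([] ++ σ) : ℝ) :=
        expect_mono fun e he => by
          exact_mod_cast opt_le_of_subset
            (pad_subset n root (ne_nil_of_mem_randomInput hB K _ e he)) (exists_cover _ _)
      refine h1.trans ((expect_opt_le K root (by simp [root]) []).trans ?_)
      rw [opt_nil, NNReal.coe_zero, zero_add]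
      exact mul_le_mul_of_nonneg_left (optRatio_le B) (by positivity))
  have hY : (0 : ℝ) < 2 ^ K * (4 / (B + 2)) := by positivity
  have hXY : (2 : ℝ) ^ K / 4 = (B + 2) / 16 * (2 ^ K * (4 / (B + 2))) := by
    field_simp
    norm_num
  rw [hXY, ENNReal.ofReal_mul (by positivity)] at key
  exact (ENNReal.mul_le_mul_iff_left (ENNReal.ofReal_pos.2 hY).ne' ENNReal.ofReal_ne_top).1 key

theorem corollary1 :
    ∃ c : ℝ, 0 < c ∧ ∃ N : ℕ, ∀ n : ℕ, N ≤ n →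
      ∃ (V : Type) (_ : Fintype V) (T : WeightedTree V) (f : ℝ≥0), 0 < f ∧
        ∀ (Ω : Type*) [MeasurableSpace Ω] (P : MeasureTheory.Measure Ω)
          [MeasureTheory.IsProbabilityMeasure P]
          (A : SumRadii.RandomizedAlgorithm T.dist f Ω),
          ENNReal.ofReal (c * Real.log (Real.log (n : ℝ))) ≤ A.competitiveRatio P n := by
  refine ⟨1 / 32, by norm_num, 16, fun n hn => ?_⟩
  -- the largest `B` with `2 ^ 4 ^ B ≤ n`
  set m := Nat.log 2 n with hm
  set B := Nat.log 4 m with hB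
  have hn0 : n ≠ 0 := by omega
  have hm4 : 4 ≤ m := Nat.le_log_of_pow_le (by norm_num) (by omega)
  have hB0 : 0 < B := Nat.log_pos (by norm_num) hm4
  have hBn : B ^ 2 ^ B ≤ n :=
    calc B ^ 2 ^ B ≤ (2 ^ B) ^ 2 ^ B := Nat.pow_le_pow_left Nat.lt_two_pow_self.le _
      _ = 2 ^ (B * 2 ^ B) := (pow_mul _ _ _).symm
      _ ≤ 2 ^ 4 ^ B := by
        refine Nat.pow_le_pow_right (by norm_num) ?_
        rw [show 4 = 2 * 2 by norm_num, mul_pow]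
        exact Nat.mul_le_mul_right _ Nat.lt_two_pow_self.le
      _ ≤ 2 ^ m := Nat.pow_le_pow_right (by norm_num) (Nat.pow_log_le_self 4 (by omega))
      _ ≤ n := Nat.pow_log_le_self 2 hn0
  refine ⟨TreeNode B (2 ^ B), inferInstance, TreeNode.tree B (2 ^ B), 1, one_pos, ?_⟩
  intro Ω _ P _ A
  refine le_sInf fun ρ hρ => le_trans (ENNReal.ofReal_le_ofReal ?_)
    (TreeNode.le_of_isCompetitive hB0 hBn hρ)
  have hlog2 : Real.log 2 ≤ 1 := by linarith [Real.log_two_lt_d9]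
  have h1 : Real.log n ≤ 4 ^ (B + 1) := by
    have hlt : n ≤ 2 ^ 4 ^ (B + 1) :=
      (Nat.lt_pow_succ_log_self (by norm_num : 1 < 2) n).le.trans
        (Nat.pow_le_pow_right (by norm_num) (Nat.lt_pow_succ_log_self (by norm_num) m))
    calc Real.log n ≤ Real.log (2 ^ 4 ^ (B + 1)) :=
          Real.log_le_log (by positivity) (by exact_mod_cast hlt)
      _ = 4 ^ (B + 1) * Real.log 2 := by rw [Real.log_pow]; push_cast; rfl
      _ ≤ 4 ^ (B + 1) := mul_le_of_le_one_right (by positivity) hlog2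
  have h2 : Real.log (Real.log n) ≤ 2 * (B + 1) := by
    have hpos : 0 < Real.log n := Real.log_pos (by exact_mod_cast (by omega : 1 < n))
    calc Real.log (Real.log n) ≤ Real.log (4 ^ (B + 1)) := Real.log_le_log hpos h1
      _ = (B + 1) * (2 * Real.log 2) := by
        rw [Real.log_pow, show (4 : ℝ) = 2 ^ 2 by norm_num, Real.log_pow]
        push_cast
        rfl
      _ ≤ (B + 1) * 2 := mul_le_mul_of_nonneg_left (by linarith) (by positivity)
      _ = 2 * (B + 1) := mul_comm _ _
  linarith
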